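/- Let $1\le k\le n$ and $\nu\ge 0$ be integers, let $V\subset\mathbb R^n$ be a bounded open set (a chart of the base, coordinates $t^1,\dots,t^n$), and let $\mathcal V\subset\mathbb R^n\times\mathbb R^\nu$ be open (coordinates $(t,x)$). Write $q=(q_i^\alpha)$ for the $\nu\times n$ matrices that stand for $\partial x^\alpha/\partial t^i$. Let $f(t,x,q)$ be a real function that is continuous on $\mathcal V\times\mathbb R^{\nu n}$ and differentiable in $q$, and consider the functional $$\mathcal F(x)=\int_V f\Big(t,x(t),\frac{Dx}{Dt}(t)\Big)\,dt .$$ The manifolds considered are graphs of maps $x(\cdot)$ of class $C^1$ on $\overline V$ (continuous on $\overline V$, differentiable in $V$, with derivative extending continuously to $\overline V$); such a manifold lies in $\mathcal V$ if $(t,x(t))\in\mathcal V$ for all $t\in\overline V$, and two of them have the same boundary if the maps agree on $\partial V$. Let $g=(g_i^\alpha(t,x))$ be a slope field, continuous on $\mathcal V$; $x(\cdot)$ is embedded in it if $\partial x^\alpha/\partial t^i=g_i^\alpha(t,x(t))$ in $V$. Put $\hat f(t,x)=f(t,x,g(t,x))$, $\hat p^i_\alpha(t,x)=\frac{\partial f}{\partial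 q_i^\alpha}(t,x,g(t,x))$ and $\omega^\alpha=dx^\alpha-\sum_j g_j^\alpha\,dt^j$. Let $S^1,\dots,S^n$ be action functions, of class $C^1$ on $\mathcal V$, and $$\mathfrak S_k=\sum_{|K|=k}(-1)^{r(K)}\,dS^{i_1}\wedge\dots\wedge dS^{i_k}\wedge dt^{I\setminus K},$$ where $I=\{1,\dots,n\}$, $K=\{i_1<\dots<i_k\}\subset I$, and $(-1)^{r(K)}$ is the sign of the permutation that puts $(K,I\setminus K)$ in ascending order. Suppose that $\hat f^{\,k-1}\ne0$ in $\mathcal V$ and that $\mathfrak S_k$ is in $\mathcal V$ the Hilbert (Poincaré–Cartan) form of $f$ and $g$, i.e. $$\mathfrak S_k=\sum_{|K|=k}\frac{(-1)^{r(K)}}{\binom nk\hat f^{\,k-1}}\Big(\bigwedge_{i\in K}\Big[\hat f\,dt^i+\frac nk\sum_\alpha\hat p^i_\alpha\,\omega^\alpha\Big]\Big)\wedge dt^{I\setminus K}\quad\text{in }\mathcal V .$$ The generalized Weierstrass function is $$\mathcal E(t,x,q,g)=f(t,x,q)-\frac1{\binom nk\hat f^{\,k-1}}\sum_{|K|=k}\det\Big\|\hat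 f\,\delta^i_j+\frac nk\sum_\alpha\hat p^i_\alpha\,(q_j^\alpha-g_j^\alpha)\Big\|_{i,j\in K}.$$ The slope field $g$ is called geodesic for $\mathfrak S_k$ in $\mathcal V$ if for every $(t,x)\in\mathcal V$ the function $q\mapsto\mathcal E(t,x,q,g)$ has its global minimum at $q=g(t,x)$. It is called locally geodesic if this minimum is local, on a ball whose radius is locally bounded away from zero in $\mathcal V$: every point of $\mathcal V$ has a neighbourhood $U$ and a $\delta>0$ such that $\mathcal E(t,x,q,g)\ge\mathcal E(t,x,g,g)$ for all $(t,x)\in U\cap\mathcal V$ and $|q-g(t,x)|<\delta$. Let $\hat x(\cdot)$ be a manifold lying in $\mathcal V$ and embedded in $g$ (the field $g$ need not be integrable). (1) If $g$ is geodesic for $\mathfrak S_k$ in $\mathcal V$, then $\mathcal F(\hat x)\le\mathcal F(x)$ for every manifold $x(\cdot)$ lying in $\mathcal V$ with the same boundary as $\hat x(\cdot)$. Moreover $\hat x$ is a strong local minimum: there is $\varepsilon>0$ such that $\mathcal F(\hat x)\le\mathcal F(x)$ for every $x(\cdot)$ of class $C^1$ on $\overline V$ with the same boundary and $|x(t)-\hat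 x(t)|<\varepsilon$ for all $t\in V$. (2) If $g$ is locally geodesic for $\mathfrak S_k$ in $\mathcal V$, then $\hat x$ is a weak local minimum: there is $\varepsilon>0$ such that $\mathcal F(\hat x)\le\mathcal F(x)$ for every $x(\cdot)$ of class $C^1$ on $\overline V$ with the same boundary, $|x(t)-\hat x(t)|<\varepsilon$ and $\big|\frac{Dx}{Dt}(t)-\frac{D\hat x}{Dt}(t)\big|<\varepsilon$ for all $t\in V$. -/

import Mathlib

namespace FieldTheory

/-- Points `t` of the chart of the base, with coordinates `t i`. -/
abbrev Base (n : ℕ) := Fin n → ℝ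

/-- Points `x` of the fibre, with coordinates `x α`. -/
abbrev Fib (ν : ℕ) := Fin ν → ℝ

/-- Values `q` of the derivatives; `q α i` is the partial derivative of `x α` in `t i`. -/
abbrev Slope (n ν : ℕ) := Fin ν → Fin n → ℝ

/-- The matrix of partial derivatives of `x` at `t`. -/
noncomputable def jac {n ν : ℕ} (x : Base n → Fib ν) (t : Base n) : Slope n ν :=
  fun α i => fderiv ℝ x t (Pi.single i 1) α

/-- `x` is of class `C¹` on the closure of the open set `V`: it is continuous on the closure,
differentiable in `V`, and its derivative extends continuously to the closure. -/
def IsC1OnClosure {n ν : ℕ} (V : Set (Base n)) (x : Base n → Fib ν) : Prop :=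
  ContinuousOn x (closure V) ∧
    ∃ D : Base n → (Base n →L[ℝ] Fib ν),
      ContinuousOn D (closure V) ∧ ∀ t ∈ V, HasFDerivAt x (D t) t

/-- The manifold `{(t, x t) : t ∈ closure V}` lies in `𝒱`. -/
def LiesIn {n ν : ℕ} (V : Set (Base n)) (𝒱 : Set (Base n × Fib ν)) (x : Base n → Fib ν) : Prop :=
  ∀ t ∈ closure V, (t, x t) ∈ 𝒱

/-- The manifolds given by `x` and `y` have the same boundary. -/
def SameBoundary {n ν : ℕ} (V : Set (Base n)) (x y : Base n → Fib ν) : Prop :=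
  ∀ t ∈ frontier V, x t = y t

/-- The manifold given by `x` is embedded in the slope field `g`. -/
def IsEmbedded {n ν : ℕ} (V : Set (Base n)) (g : Base n → Fib ν → Slope n ν)
    (x : Base n → Fib ν) : Prop :=
  ∀ t ∈ V, jac x t = g t (x t)

/-- The functional `∫_V f(t, x, Dx/Dt) dt`. -/
noncomputable def functional {n ν : ℕ} (V : Set (Base n))
    (f : Base n → Fib ν → Slope n ν → ℝ) (x : Base n → Fib ν) : ℝ :=
  ∫ t in V, f t (x t) (jac x t)

/-- The momentum `p^i_α`, the partial derivative of `f` in `q α i`. -/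
noncomputable def momentum {n ν : ℕ} (f : Base n → Fib ν → Slope n ν → ℝ)
    (t : Base n) (x : Fib ν) (q : Slope n ν) (i : Fin n) (α : Fin ν) : ℝ :=
  fderiv ℝ (f t x) q (Pi.single α (Pi.single i 1))

/-- The principal minor of `C` with row and column indices in `K`. -/
noncomputable def principalMinor {n : ℕ} (C : Matrix (Fin n) (Fin n) ℝ) (K : Finset (Fin n)) : ℝ :=
  (C.submatrix (fun i : K => (i : Fin n)) (fun i : K => (i : Fin n))).det

/-- The generalized Weierstrass function of order `k` of the slope field `g`,
`f(q) - ∑_{|K| = k} det ‖f̂ I + (n/k) p̂ (q - g)‖_K / (C(n,k) f̂^(k-1))`,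
where `f̂` and `p̂` are taken at `q = g`. -/
noncomputable def weierstrass {n ν : ℕ} (k : ℕ) (f : Base n → Fib ν → Slope n ν → ℝ)
    (g : Base n → Fib ν → Slope n ν) (t : Base n) (x : Fib ν) (q : Slope n ν) : ℝ :=
  f t x q -
    ∑ K ∈ (Finset.univ : Finset (Fin n)).powersetCard k,
      1 / ((n.choose k : ℝ) * f t x (g t x) ^ (k - 1)) *
        principalMinor
          (Matrix.of fun i j =>
            f t x (g t x) * (1 : Matrix (Fin n) (Fin n) ℝ) i j +
              (n : ℝ) / (k : ℝ) *
                ∑ α, momentum f t x (g t x) i α * (q α j - g t x α j)) K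

/-- The exterior product `θ 0 ∧ ⋯ ∧ θ (n-1)` of `n` covectors on the space of pairs `(t, x)`. -/
noncomputable def wedge {n ν : ℕ} (θ : Fin n → (Base n × Fib ν →ₗ[ℝ] ℝ)) :
    (Base n × Fib ν) [⋀^Fin n]→ₗ[ℝ] ℝ :=
  Matrix.detRowAlternating.compLinearMap (LinearMap.pi θ)

theorem wedge_apply {n ν : ℕ} (θ : Fin n → (Base n × Fib ν →ₗ[ℝ] ℝ)) (v : Fin n → Base n × Fib ν) :
    wedge θ v = (Matrix.of fun j i => θ i (v j)).det := rfl

/-- The covector `dt^i`. -/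
def dt {n ν : ℕ} (i : Fin n) : Base n × Fib ν →ₗ[ℝ] ℝ :=
  LinearMap.proj i ∘ₗ LinearMap.fst ℝ (Base n) (Fib ν)

/-- The covector `dx^α`. -/
def dx {n ν : ℕ} (α : Fin ν) : Base n × Fib ν →ₗ[ℝ] ℝ :=
  LinearMap.proj α ∘ₗ LinearMap.snd ℝ (Base n) (Fib ν)

/-- The covector `dS^i` at the point `z`. -/
noncomputable def dS {n ν : ℕ} (S : Base n × Fib ν → Fin n → ℝ) (z : Base n × Fib ν) (i : Fin n) :
    Base n × Fib ν →ₗ[ℝ] ℝ :=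
  (fderiv ℝ (fun w => S w i) z : Base n × Fib ν →ₗ[ℝ] ℝ)

/-- The canonical form `ω^α = dx^α - ∑_j g_j^α dt^j` of the slope field `g` at `z`. -/
noncomputable def canonicalForm {n ν : ℕ} (g : Base n → Fib ν → Slope n ν) (z : Base n × Fib ν)
    (α : Fin ν) : Base n × Fib ν →ₗ[ℝ] ℝ :=
  dx α - ∑ j, g z.1 z.2 α j • dt j

/-- The differential form `𝔖_k = ∑_{|K| = k} (-1)^{r(K)} dS^{i_1} ⋯ dS^{i_k} dt^{I∖K}` of the
action functions `S`. The sign `(-1)^{r(K)}` puts all factors in the ascending order of their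
indices, so each summand is the product over `i` of `dS^i` for `i ∈ K` and `dt^i` for `i ∉ K`. -/
noncomputable def actionForm {n ν : ℕ} (k : ℕ) (S : Base n × Fib ν → Fin n → ℝ)
    (z : Base n × Fib ν) : (Base n × Fib ν) [⋀^Fin n]→ₗ[ℝ] ℝ :=
  ∑ K ∈ (Finset.univ : Finset (Fin n)).powersetCard k,
    wedge fun i => if i ∈ K then dS S z i else dt i

/-- The Poincaré–Cartan (Hilbert) form of order `k` of the integrand `f` and the slope field `g`,
`∑_{|K| = k} (-1)^{r(K)} ∏_{i ∈ K} (f̂ dt^i + (n/k) ∑_α p̂^i_α ω^α) dt^{I∖K} / (C(n,k) f̂^(k-1))`,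
with the factors again put in the ascending order of their indices. -/
noncomputable def hilbertForm {n ν : ℕ} (k : ℕ) (f : Base n → Fib ν → Slope n ν → ℝ)
    (g : Base n → Fib ν → Slope n ν) (z : Base n × Fib ν) :
    (Base n × Fib ν) [⋀^Fin n]→ₗ[ℝ] ℝ :=
  ∑ K ∈ (Finset.univ : Finset (Fin n)).powersetCard k,
    (1 / ((n.choose k : ℝ) * f z.1 z.2 (g z.1 z.2) ^ (k - 1))) •
      wedge fun i =>
        if i ∈ K then
          f z.1 z.2 (g z.1 z.2) • dt i +
            ((n : ℝ) / (k : ℝ)) •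
              ∑ α, momentum f z.1 z.2 (g z.1 z.2) i α • canonicalForm g z α
        else dt i

/-- The form `𝔖_k` of the action functions `S` is, in `𝒱`, the Hilbert form of order `k` of `f` and
`g` (which involves the division by `f̂^(k-1)`). -/
def Represents {n ν : ℕ} (k : ℕ) (f : Base n → Fib ν → Slope n ν → ℝ)
    (S : Base n × Fib ν → Fin n → ℝ) (𝒱 : Set (Base n × Fib ν))
    (g : Base n → Fib ν → Slope n ν) : Prop :=
  ∀ z ∈ 𝒱, f z.1 z.2 (g z.1 z.2) ^ (k - 1) ≠ 0 ∧ hilbertForm k f g z = actionForm k S z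

/-- The slope field `g` is geodesic for `𝔖_k` in `𝒱`: at each point of `𝒱` the Weierstrass
function has its (global) minimum in `q` at `q = g`. -/
def IsGeodesic {n ν : ℕ} (k : ℕ) (f : Base n → Fib ν → Slope n ν → ℝ)
    (S : Base n × Fib ν → Fin n → ℝ) (𝒱 : Set (Base n × Fib ν))
    (g : Base n → Fib ν → Slope n ν) : Prop :=
  Represents k f S 𝒱 g ∧
    ∀ z ∈ 𝒱, ∀ q : Slope n ν,
      weierstrass k f g z.1 z.2 (g z.1 z.2) ≤ weierstrass k f g z.1 z.2 q

/-- The slope field `g` is geodesic for `𝔖_k` in `𝒱` in the sense of local minima: at each point of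
`𝒱` the Weierstrass function has a local minimum in `q` at `q = g`, the radius of the neighbourhood
of `g` being locally bounded away from zero in `𝒱`. -/
def IsLocallyGeodesic {n ν : ℕ} (k : ℕ) (f : Base n → Fib ν → Slope n ν → ℝ)
    (S : Base n × Fib ν → Fin n → ℝ) (𝒱 : Set (Base n × Fib ν))
    (g : Base n → Fib ν → Slope n ν) : Prop :=
  Represents k f S 𝒱 g ∧
    ∀ z₀ ∈ 𝒱, ∃ U ∈ nhds z₀, ∃ δ : ℝ, 0 < δ ∧
      ∀ z ∈ 𝒱 ∩ U, ∀ q : Slope n ν, ‖q - g z.1 z.2‖ < δ →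
        weierstrass k f g z.1 z.2 (g z.1 z.2) ≤ weierstrass k f g z.1 z.2 q

/-- `y` gives a strong local minimum: it minimizes the functional among all `C¹` manifolds with the
same boundary that are close to it in the uniform norm. -/
def IsStrongLocalMin {n ν : ℕ} (V : Set (Base n)) (f : Base n → Fib ν → Slope n ν → ℝ)
    (y : Base n → Fib ν) : Prop :=
  ∃ ε : ℝ, 0 < ε ∧ ∀ x : Base n → Fib ν, IsC1OnClosure V x → SameBoundary V x y →
    (∀ t ∈ V, ‖x t - y t‖ < ε) → functional V f y ≤ functional V f x

/-- `y` gives a weak local minimum: it minimizes the functional among all `C¹` manifolds with the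
same boundary that are close to it in the `C¹` norm. -/
def IsWeakLocalMin {n ν : ℕ} (V : Set (Base n)) (f : Base n → Fib ν → Slope n ν → ℝ)
    (y : Base n → Fib ν) : Prop :=
  ∃ ε : ℝ, 0 < ε ∧ ∀ x : Base n → Fib ν, IsC1OnClosure V x → SameBoundary V x y →
    (∀ t ∈ V, ‖x t - y t‖ < ε) → (∀ t ∈ V, ‖jac x t - jac y t‖ < ε) →
    functional V f y ≤ functional V f x

end FieldTheory

/-! This is Weierstrass's argument with an independent integral. On the tangent vectors of the graph
of `x`, the form of the action functions is the sum of the principal `k`-minors of the derivative of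
`t ↦ S (t, x t)`, while the Hilbert form is exactly what the Weierstrass function subtracts from
`f`. The two forms coincide, so along every manifold the Weierstrass function is `f` minus that sum
of minors (`weierstrass_jac_eq`). It vanishes at `q = g` (`weierstrass_self`), so a minimum there
gives `f ≥` minors along the competitor, with equality along the embedded manifold. It remains to
see that the integral of the minors depends only on the boundary values
(`setIntegral_minorSum_fderiv_eq`).

Since `S` is only `C¹` and the boundary of `V` is arbitrary, this is proved by change of variables
instead of Stokes' theorem. If `w` is `C¹` with compact support, then `id + s w` permutes the
support of `w` for small `s`. Hence `∫ det (1 + s Dw)` over the support does not depend on `s`, and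
its `s^k` coefficient, the integral of the `k`-minors, is zero for `k ≥ 1`. A cutoff carries this
over to two maps on `V` that differ by a compactly supported one. A difference that merely vanishes
on the boundary is truncated near the value zero; the truncation is removed by dominated
convergence, because the derivative of each coordinate vanishes almost everywhere on the zero set of
that coordinate.

The local statements follow from compactness of the graph over the closure of `V`. -/

section

open MeasureTheory Filter Topology

namespace FieldTheory

/-! ### Sums of principal minors and maps with compact support -/

/-- The sum of the determinants obtained from the identity matrix by replacing `k` of its rows by
the rows of `A`; it is the sum of the principal `k`-minors of `A`. -/
noncomputable def minorSum {n : ℕ} (k : ℕ) (A : Base n →L[ℝ] Base n) : ℝ :=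
  ∑ K ∈ (Finset.univ : Finset (Fin n)).powersetCard k,
    (Matrix.of fun i j => if i ∈ K then A (Pi.single j 1) i
      else (1 : Matrix (Fin n) (Fin n) ℝ) i j).det

theorem continuous_minorSum {n : ℕ} (k : ℕ) :
    Continuous (minorSum k : (Base n →L[ℝ] Base n) → ℝ) := by
  unfold minorSum
  refine continuous_finsetSum _ fun K _ => Continuous.matrix_det ?_
  refine continuous_pi fun i => continuous_pi fun j => ?_
  by_cases h : i ∈ K
  · simp only [Matrix.of_apply, h, if_true]
    fun_prop
  · simp only [Matrix.of_apply, h, if_false]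
    fun_prop

theorem minorSum_zero_left {n : ℕ} (A : Base n →L[ℝ] Base n) : minorSum 0 A = 1 := by
  simp only [minorSum, Finset.powersetCard_zero, Finset.sum_singleton, Finset.notMem_empty,
    if_false]
  exact Matrix.det_one

theorem minorSum_zero_right {n k : ℕ} (hk : 1 ≤ k) : minorSum k (0 : Base n →L[ℝ] Base n) = 0 := by
  refine Finset.sum_eq_zero fun K hK => ?_
  obtain ⟨i, hi⟩ : K.Nonempty := by
    rw [← Finset.card_pos, (Finset.mem_powersetCard.1 hK).2]
    exact hk
  exact Matrix.det_eq_zero_of_row_eq_zero i fun j => by simp [hi]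

/-- The determinant is multilinear in the rows: `K` records which rows are taken from `s • A`, and
each such row contributes one factor `s`. -/
theorem det_one_add_smul {n : ℕ} (s : ℝ) (A : Base n →L[ℝ] Base n) :
    (1 + s • A).det = ∑ k ∈ Finset.range (n + 1), s ^ k * minorSum k A := by
  have hdet : (1 + s • A).det =
      Matrix.detRowAlternating.toMultilinearMap
        ((fun i => s • fun j => A (Pi.single j 1) i) +
          fun i => (1 : Matrix (Fin n) (Fin n) ℝ) i) := by
    rw [ContinuousLinearMap.det, ← LinearMap.det_toMatrix']
    change Matrix.det _ = Matrix.det _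
    congr 1
    ext i j
    simp [LinearMap.toMatrix'_apply, Matrix.one_apply, Pi.single_apply, add_comm]
  rw [hdet, MultilinearMap.map_add_univ, ← Finset.powerset_univ,
    Finset.sum_powerset, Finset.card_univ, Fintype.card_fin]
  refine Finset.sum_congr rfl fun k _ => ?_
  rw [minorSum, Finset.mul_sum]
  refine Finset.sum_congr rfl fun K hK => ?_
  have h := Matrix.detRowAlternating.toMultilinearMap.map_piecewise_smul (fun _ => s)
    (fun i j => if i ∈ K then A (Pi.single j 1) i else (1 : Matrix (Fin n) (Fin n) ℝ) i j) K
  rw [Finset.prod_const, (Finset.mem_powersetCard.1 hK).2] at h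
  refine Eq.trans ?_ h
  congr 1
  funext i
  by_cases hi : i ∈ K <;> simp [hi]

theorem bijective_id_add {E : Type*} [NormedAddCommGroup E] [NormedSpace ℝ E] [CompleteSpace E]
    {w : E → E} {L : NNReal} (hw : LipschitzWith L w) (hL : L < 1) :
    Function.Bijective fun t => t + w t := by
  have happ : ApproximatesLinearOn (fun t => t + w t)
      (ContinuousLinearEquiv.refl ℝ E : E →L[ℝ] E) Set.univ L := by
    intro a _ b _
    change ‖a + w a - (b + w b) - (a - b)‖ ≤ L * ‖a - b‖
    rw [show a + w a - (b + w b) - (a - b) = w a - w b by abel]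
    exact hw.norm_sub_le a b
  rcases subsingleton_or_nontrivial E with h | h
  · exact ⟨Set.injOn_univ.1 (happ.injOn (Or.inl h)), happ.surjective (Or.inl h)⟩
  · have hlt : L < ‖((ContinuousLinearEquiv.refl ℝ E).symm : E →L[ℝ] E)‖₊⁻¹ := by
      simpa using hL
    exact ⟨Set.injOn_univ.1 (happ.injOn (Or.inr hlt)), happ.surjective (Or.inr hlt)⟩

/-- The map is the identity off `B`, so it maps the complement of `B` onto itself; a bijection then
does the same with `B`. -/
theorem image_id_add_eq {E : Type*} [AddZeroClass E] {w : E → E}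
    (hw : Function.Bijective fun t => t + w t) {B : Set E} (hB : ∀ t ∉ B, w t = 0) :
    (fun t => t + w t) '' B = B := by
  have hc : (fun t => t + w t) '' Bᶜ = Bᶜ := by
    ext t
    constructor
    · rintro ⟨s, hs, rfl⟩
      simpa [hB s hs] using hs
    · intro ht
      exact ⟨t, ht, by simp [hB t ht]⟩
  rw [← compl_compl B, Set.image_compl_eq hw, hc]

/-- For small `s` the map `id + s w` is a bijection with positive Jacobian on the support of `w` and
maps that support onto itself, so the change of variables formula returns the volume of the support.
-/
theorem setIntegral_det_one_add_smul_fderiv {n : ℕ} {w : Base n → Base n} (hw : ContDiff ℝ 1 w)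
    (hc : HasCompactSupport w) :
    ∀ᶠ s : ℝ in 𝓝 0, ∫ t in tsupport w, (1 + s • fderiv ℝ w t).det =
      ∫ _ in tsupport w, (1 : ℝ) := by
  obtain ⟨L, hL⟩ := hw.lipschitzWith_of_hasCompactSupport hc one_ne_zero
  have hpos : ∀ᶠ s : ℝ in 𝓝 0, ∀ t ∈ tsupport w, 0 < (1 + s • fderiv ℝ w t).det := by
    have hcont : Continuous fun p : ℝ × Base n => (1 + p.1 • fderiv ℝ w p.2).det := by
      have := hw.continuous_fderiv one_ne_zero
      exact ContinuousLinearMap.continuous_det.comp (by fun_prop)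
    refine IsCompact.eventually_forall_of_forall_eventually hc fun t _ => ?_
    refine hcont.continuousAt.eventually (lt_mem_nhds ?_)
    simp [ContinuousLinearMap.det]
  have hsmall : ∀ᶠ s : ℝ in 𝓝 0, ‖s‖₊ * L < 1 := by
    have hcont : Continuous fun s : ℝ => ‖s‖₊ * L := by fun_prop
    exact hcont.continuousAt.eventually (gt_mem_nhds (by simp))
  filter_upwards [hpos, hsmall] with s hs hsL
  have hbij : Function.Bijective fun t => t + s • w t :=
    bijective_id_add ((lipschitzWith_smul s).comp hL) hsL
  have himg := image_id_add_eq hbij (B := tsupport w) fun _ ht => by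
    simp [image_eq_zero_of_notMem_tsupport ht]
  have hder : ∀ t ∈ tsupport w, HasFDerivWithinAt (fun t => t + s • w t)
      (1 + s • fderiv ℝ w t) (tsupport w) t := fun t _ =>
    ((hasFDerivAt_id t).add ((hw.differentiable one_ne_zero t).hasFDerivAt.const_smul s)
      ).hasFDerivWithinAt
  have h := integral_image_eq_integral_abs_det_fderiv_smul volume
    (isClosed_tsupport w).measurableSet hder hbij.injective.injOn fun _ => (1 : ℝ)
  rw [himg] at h
  rw [h]
  refine setIntegral_congr_fun (isClosed_tsupport w).measurableSet fun t ht => ?_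
  simp [abs_of_pos (hs t ht)]

theorem coeff_eq_zero_of_eventually {n : ℕ} {c : ℕ → ℝ}
    (h : ∀ᶠ s : ℝ in 𝓝 0, ∑ k ∈ Finset.range n, s ^ k * c k = 0) {k : ℕ} (hk : k < n) :
    c k = 0 := by
  set p : Polynomial ℝ := ∑ k ∈ Finset.range n, Polynomial.monomial k (c k) with hp
  have hp0 : p = 0 := by
    refine Polynomial.eq_zero_of_infinite_isRoot p ((infinite_of_mem_nhds 0 h).mono fun s hs => ?_)
    change p.eval s = 0
    rw [← hs, hp, Polynomial.eval_finsetSum]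
    exact Finset.sum_congr rfl fun k _ => by rw [Polynomial.eval_monomial, mul_comm]
  have := congrArg (fun q => Polynomial.coeff q k) hp0
  simpa [hp, Polynomial.coeff_monomial, hk] using this

/-- The integral of a homogeneous null Lagrangian of positive degree vanishes on maps with compact
support. -/
theorem integral_minorSum_fderiv_eq_zero {n k : ℕ} (hk : 1 ≤ k) {w : Base n → Base n}
    (hw : ContDiff ℝ 1 w) (hc : HasCompactSupport w) :
    ∫ t, minorSum k (fderiv ℝ w t) = 0 := by
  have hD := hw.continuous_fderiv one_ne_zero
  have hsupp : ∀ t ∉ tsupport w, minorSum k (fderiv ℝ w t) = 0 := fun t ht => by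
    rw [image_eq_zero_of_notMem_tsupport fun h => ht (tsupport_fderiv_subset ℝ h),
      minorSum_zero_right hk]
  rw [← setIntegral_eq_integral_of_forall_compl_eq_zero hsupp]
  rcases lt_or_ge n k with hkn | hkn
  · have : ∀ A : Base n →L[ℝ] Base n, minorSum k A = 0 := fun A => by
      rw [minorSum, Finset.powersetCard_eq_empty.2 (by simpa using hkn), Finset.sum_empty]
    simp [this]
  have hint : ∀ j, IntegrableOn (fun t => minorSum j (fderiv ℝ w t)) (tsupport w) := fun j =>
    ((continuous_minorSum j).comp hD).continuousOn.integrableOn_compact hc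
  have h := setIntegral_det_one_add_smul_fderiv hw hc
  -- The constant term is the volume of the support and cancels against the right-hand side, hence
  -- the zero coefficient at `j = 0`.
  have h' : ∀ᶠ s : ℝ in 𝓝 0, ∑ j ∈ Finset.range (n + 1), s ^ j *
      (if j = 0 then 0 else ∫ t in tsupport w, minorSum j (fderiv ℝ w t)) = 0 := by
    filter_upwards [h] with s hs
    simp_rw [det_one_add_smul] at hs
    rw [integral_finsetSum _ fun j _ => (hint j).const_mul _] at hs
    simp_rw [integral_const_mul] at hs
    rw [Finset.sum_range_succ'] at hs ⊢
    simpa [minorSum_zero_left] using hs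
  have := coeff_eq_zero_of_eventually h' (Nat.lt_succ_of_le hkn)
  simpa [Nat.one_le_iff_ne_zero.1 hk] using this

/-! ### Cutoffs and compactly supported variations -/

theorem exists_contDiff_hasCompactSupport_eventuallyEq_one {E : Type*} [NormedAddCommGroup E]
    [NormedSpace ℝ E] [FiniteDimensional ℝ E] {K V : Set E} (hK : IsCompact K) (hV : IsOpen V)
    (hKV : K ⊆ V) :
    ∃ χ : E → ℝ, ContDiff ℝ 1 χ ∧ HasCompactSupport χ ∧ tsupport χ ⊆ V ∧
      ∀ t ∈ K, ∀ᶠ s in 𝓝 t, χ s = 1 := by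
  obtain ⟨L, hL, hKL, hLV⟩ := exists_compact_between hK hV hKV
  obtain ⟨χ, h1, h0, -⟩ := exists_contMDiffMap_one_nhds_of_subset_interior
    (modelWithCornersSelf ℝ E) (n := 1) hK.isClosed hKL
  have hsub : tsupport χ ⊆ L :=
    closure_minimal (fun t ht => by_contra fun h => ht (h0 t h)) hL.isClosed
  refine ⟨χ, χ.contMDiff.contDiff, hL.of_isClosed_subset (isClosed_tsupport _) hsub,
    hsub.trans hLV, fun t ht => ?_⟩
  exact h1.filter_mono (nhds_le_nhdsSet ht)

theorem contDiff_smul_of_tsupport_subset {E F : Type*} [NormedAddCommGroup E]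
    [NormedSpace ℝ E] [NormedAddCommGroup F] [NormedSpace ℝ F] {V : Set E} (hV : IsOpen V)
    {χ : E → ℝ} (hχ : ContDiff ℝ 1 χ) (hχV : tsupport χ ⊆ V) {ψ : E → F}
    (hψ : ContDiffOn ℝ 1 ψ V) : ContDiff ℝ 1 fun t => χ t • ψ t := by
  refine contDiff_iff_contDiffAt.2 fun t => ?_
  by_cases ht : t ∈ V
  · exact hχ.contDiffAt.smul (hψ.contDiffAt (hV.mem_nhds ht))
  · have h0 : (fun t => χ t • ψ t) =ᶠ[𝓝 t] fun _ => 0 := by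
      have := notMem_tsupport_iff_eventuallyEq.1 fun h => ht (hχV h)
      filter_upwards [this] with s hs
      simp [hs]
    exact contDiffAt_const.congr_of_eventuallyEq h0

/-- The integrand vanishes off the support of `u`, so `ψ` may be replaced by `χ • ψ` with `χ = 1`
near that support. Both resulting maps are `C¹` with compact support on the whole space, and each
integral is zero. -/
theorem setIntegral_minorSum_add_sub_eq_zero {n k : ℕ} (hk : 1 ≤ k) {V : Set (Base n)}
    (hV : IsOpen V) {ψ u : Base n → Base n} (hψ : ContDiffOn ℝ 1 ψ V) (hu : ContDiff ℝ 1 u)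
    (huc : HasCompactSupport u) (huV : tsupport u ⊆ V) :
    ∫ t in V, (minorSum k (fderiv ℝ ψ t + fderiv ℝ u t) - minorSum k (fderiv ℝ ψ t)) = 0 := by
  obtain ⟨χ, hχ, hχc, hχV, hχ1⟩ := exists_contDiff_hasCompactSupport_eventuallyEq_one huc hV huV
  set w : Base n → Base n := fun t => χ t • ψ t with hwdef
  have hw : ContDiff ℝ 1 w := contDiff_smul_of_tsupport_subset hV hχ hχV hψ
  have hwc : HasCompactSupport w := hχc.smul_right
  have hu0 : ∀ t ∉ tsupport u, fderiv ℝ u t = 0 := fun t ht =>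
    image_eq_zero_of_notMem_tsupport fun h => ht (tsupport_fderiv_subset ℝ h)
  have hint : ∀ {v : Base n → Base n}, ContDiff ℝ 1 v → HasCompactSupport v →
      Integrable fun t => minorSum k (fderiv ℝ v t) := fun hv hvc =>
    ((continuous_minorSum k).comp (hv.continuous_fderiv one_ne_zero)).integrable_of_hasCompactSupport
      ((hvc.fderiv ℝ).comp_left (minorSum_zero_right hk))
  have hpt : ∀ t, minorSum k (fderiv ℝ ψ t + fderiv ℝ u t) - minorSum k (fderiv ℝ ψ t) =
      minorSum k (fderiv ℝ (w + u) t) - minorSum k (fderiv ℝ w t) := fun t => by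
    rw [fderiv_add (hw.differentiable one_ne_zero t) (hu.differentiable one_ne_zero t)]
    by_cases ht : t ∈ tsupport u
    · have : w =ᶠ[𝓝 t] ψ := by
        filter_upwards [hχ1 t ht] with s hs
        simp [hwdef, hs]
      rw [this.fderiv_eq]
    · simp [hu0 t ht]
  have hout : ∀ t ∉ V, minorSum k (fderiv ℝ ψ t + fderiv ℝ u t) - minorSum k (fderiv ℝ ψ t) = 0 :=
    fun t ht => by simp [hu0 t fun h => ht (huV h)]
  rw [setIntegral_eq_integral_of_forall_compl_eq_zero hout]
  simp_rw [hpt]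
  have hwu : ContDiff ℝ 1 (w + u) := hw.add hu
  rw [integral_sub (hint hwu (hwc.add huc)) (hint hw hwc),
    integral_minorSum_fderiv_eq_zero hk hwu (hwc.add huc),
    integral_minorSum_fderiv_eq_zero hk hw hwc, sub_zero]

/-! ### Truncation near the value zero -/

/-- The rescaled functions `ε η(s / ε)` vanish for `|s| ≤ ε`, have slope one for `|s| > 2ε`, and
have derivatives bounded independently of `ε`. -/
theorem exists_truncation : ∃ η : ℝ → ℝ, ContDiff ℝ 1 η ∧ (∀ s, |s| ≤ 1 → η s = 0) ∧
    (∃ C, ∀ s, |deriv η s| ≤ C) ∧ ∀ s, 2 < |s| → deriv η s = 1 := by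
  have hη : ContDiff ℝ 1 fun s : ℝ => s * Real.smoothTransition (s ^ 2 - 1) := by
    have := Real.smoothTransition.contDiff (n := 1)
    exact contDiff_id.mul (this.comp (by fun_prop))
  have h1 : ∀ s, 2 < |s| → deriv (fun s : ℝ => s * Real.smoothTransition (s ^ 2 - 1)) s = 1 := by
    intro s hs
    have hev : (fun s : ℝ => s * Real.smoothTransition (s ^ 2 - 1)) =ᶠ[𝓝 s] id := by
      filter_upwards [continuous_abs.continuousAt.eventually (lt_mem_nhds hs)] with r hr
      rw [Real.smoothTransition.one_of_one_le (by nlinarith [sq_abs r]), mul_one, id]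
    rw [hev.deriv_eq, deriv_id]
  refine ⟨_, hη, fun s hs => ?_, ?_, h1⟩
  · rw [Real.smoothTransition.zero_of_nonpos (by nlinarith [sq_abs s, abs_nonneg s]), mul_zero]
  · obtain ⟨C, hC⟩ := (isCompact_Icc (a := (-2 : ℝ)) (b := 2)).exists_bound_of_continuousOn
      (hη.continuous_deriv le_rfl).continuousOn
    refine ⟨max C 1, fun s => ?_⟩
    rcases le_or_gt |s| 2 with hs | hs
    · exact (hC s (abs_le.1 hs)).trans (le_max_left _ _)
    · rw [h1 s hs, abs_one]
      exact le_max_right _ _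

/-- At almost every zero of a differentiable function its derivative vanishes. -/
theorem ae_fderiv_eq_zero_of_eq_zero {E : Type*} [NormedAddCommGroup E] [NormedSpace ℝ E]
    [FiniteDimensional ℝ E] [MeasurableSpace E] [BorelSpace E] (μ : Measure E)
    [μ.IsAddHaarMeasure] {V : Set E} (hV : IsOpen V) {h : E → ℝ} {h' : E → E →L[ℝ] ℝ}
    (hh : ∀ t ∈ V, HasFDerivAt h (h' t) t) :
    ∀ᵐ t ∂μ.restrict V, h t = 0 → h' t = 0 := by
  rcases subsingleton_or_nontrivial E with hE | hE
  · refine Eventually.of_forall fun t _ => ?_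
    ext v
    rw [Subsingleton.elim v 0, map_zero, map_zero]
  -- Multiplying by a fixed nonzero vector turns `h` into a map from `E` to itself, the setting of
  -- `ApproximatesLinearOn.norm_fderiv_sub_le`. On the zero set this map is approximated by the zero
  -- map with constant `0`.
  obtain ⟨e, he⟩ := exists_ne (0 : E)
  set s : Set E := V ∩ {t | h t = 0}
  have hs : MeasurableSet s := by
    have hcont : ContinuousOn h V := fun t ht => (hh t ht).continuousAt.continuousWithinAt
    have : s = V \ (V ∩ h ⁻¹' {0}ᶜ) := by
      ext t
      simp only [s, Set.mem_inter_iff, Set.mem_ofPred_eq, Set.mem_sdiff, Set.mem_preimage,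
        Set.mem_compl_iff, Set.mem_singleton_iff]
      tauto
    rw [this]
    exact hV.measurableSet.diff (hcont.isOpen_inter_preimage hV isOpen_compl_singleton).measurableSet
  have happ : ApproximatesLinearOn (fun t => h t • e) (0 : E →L[ℝ] E) s 0 := by
    intro a ha b hb
    simp [show h a = 0 from ha.2, show h b = 0 from hb.2]
  have hae := happ.norm_fderiv_sub_le μ hs (fun t => (h' t).smulRight e) fun t ht =>
    ((hh t ht.1).smul_const e).hasFDerivWithinAt
  rw [ae_restrict_iff' hs] at hae
  rw [ae_restrict_iff' hV.measurableSet]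
  filter_upwards [hae] with t ht htV h0
  have hz := ht ⟨htV, h0⟩
  rw [sub_zero, nonpos_iff_eq_zero, nnnorm_eq_zero] at hz
  ext v
  have := congrArg (fun A : E →L[ℝ] E => A v) hz
  simpa [he] using this

/-- The coordinatewise truncation of `u` at the scale `ε`, extended by zero outside `V`. -/
noncomputable def truncate {n : ℕ} (V : Set (Base n)) (η : ℝ → ℝ) (ε : ℝ) (u : Base n → Base n) :
    Base n → Base n :=
  open Classical in fun t => if t ∈ V then fun j => ε * η (ε⁻¹ * u t j) else 0

section truncate

variable {n : ℕ} {V : Set (Base n)} {η : ℝ → ℝ} {ε : ℝ} {u : Base n → Base n}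

theorem truncate_eventuallyEq (hV : IsOpen V) {t : Base n} (ht : t ∈ V) :
    truncate V η ε u =ᶠ[𝓝 t] fun t j => ε * η (ε⁻¹ * u t j) := by
  filter_upwards [hV.mem_nhds ht] with s hs
  simp [truncate, hs]

theorem fderiv_truncate (hV : IsOpen V) (hη : ContDiff ℝ 1 η) (hε : 0 < ε) {t : Base n}
    (ht : t ∈ V) (hu : DifferentiableAt ℝ u t) :
    fderiv ℝ (truncate V η ε u) t = ContinuousLinearMap.pi fun j =>
      deriv η (ε⁻¹ * u t j) • (ContinuousLinearMap.proj j ∘L fderiv ℝ u t) := by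
  rw [(truncate_eventuallyEq hV ht).fderiv_eq]
  refine HasFDerivAt.fderiv (hasFDerivAt_pi.2 fun j => ?_)
  have huj : HasFDerivAt (fun t => u t j) (ContinuousLinearMap.proj j ∘L fderiv ℝ u t) t :=
    hasFDerivAt_pi'.1 hu.hasFDerivAt j
  have h := (((hη.differentiable one_ne_zero (ε⁻¹ * u t j)).hasDerivAt.comp_hasFDerivAt t
    (huj.const_mul ε⁻¹))).const_mul ε
  refine h.congr_fderiv ?_
  rw [smul_smul, smul_smul]
  congr 1
  field_simp

/-- Where `‖u‖ < ε` every coordinate falls in the range on which `η` vanishes. The support therefore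
lies in the part of the closure with `‖u‖ ≥ ε`, which is compact and misses the frontier. -/
theorem tsupport_truncate_subset (hVb : Bornology.IsBounded V) (hη : ∀ s, |s| ≤ 1 → η s = 0)
    (hε : 0 < ε) (hu : ContinuousOn u (closure V)) (hu0 : ∀ t ∈ frontier V, u t = 0)
    (hV : IsOpen V) :
    HasCompactSupport (truncate V η ε u) ∧ tsupport (truncate V η ε u) ⊆ V := by
  set K : Set (Base n) := closure V ∩ (fun t => ‖u t‖) ⁻¹' Set.Ici ε
  have hKcl : IsClosed K := hu.norm.preimage_isClosed_of_isClosed isClosed_closure isClosed_Ici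
  have hK : IsCompact K := hVb.isCompact_closure.of_isClosed_subset hKcl Set.inter_subset_left
  have hKV : K ⊆ V := fun t ht => by_contra fun h => by
    have h0 := hu0 t (hV.frontier_eq ▸ ⟨ht.1, h⟩)
    have : ε ≤ ‖u t‖ := ht.2
    rw [h0, norm_zero] at this
    linarith
  have hsub : tsupport (truncate V η ε u) ⊆ K := by
    refine closure_minimal (fun t ht => ?_) hKcl
    have htV : t ∈ V := by_contra fun h => ht (by simp [truncate, h])
    refine ⟨subset_closure htV, ?_⟩
    change ε ≤ ‖u t‖
    refine le_of_not_gt fun hlt => ht ?_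
    rw [truncate, if_pos htV]
    funext j
    have hj : |u t j| ≤ ε := (norm_le_pi_norm (u t) j).trans (le_of_lt hlt)
    rw [hη _ (by rw [abs_mul, abs_inv, abs_of_pos hε, inv_mul_le_iff₀ hε, mul_one]; exact hj)]
    simp
  exact ⟨hK.of_isClosed_subset (isClosed_tsupport _) hsub, hsub.trans hKV⟩

theorem contDiff_truncate (hV : IsOpen V) (hη : ContDiff ℝ 1 η) (hu : ContDiffOn ℝ 1 u V)
    (hsupp : tsupport (truncate V η ε u) ⊆ V) : ContDiff ℝ 1 (truncate V η ε u) := by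
  refine contDiff_iff_contDiffAt.2 fun t => ?_
  by_cases ht : t ∈ V
  · refine ContDiffAt.congr_of_eventuallyEq ?_ (truncate_eventuallyEq hV ht)
    have hut := hu.contDiffAt (hV.mem_nhds ht)
    refine contDiffAt_pi.2 fun j => contDiffAt_const.mul (hη.contDiffAt.comp t ?_)
    exact contDiffAt_const.mul (contDiffAt_pi.1 hut j)
  · exact contDiffAt_const.congr_of_eventuallyEq
      (notMem_tsupport_iff_eventuallyEq.1 fun h => ht (hsupp h))

theorem norm_fderiv_truncate_le (hV : IsOpen V) (hη : ContDiff ℝ 1 η) (hε : 0 < ε) {C : ℝ}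
    (hC : ∀ s, |deriv η s| ≤ C) {t : Base n} (ht : t ∈ V) (hu : DifferentiableAt ℝ u t) :
    ‖fderiv ℝ (truncate V η ε u) t‖ ≤ C * ‖fderiv ℝ u t‖ := by
  have hC0 : 0 ≤ C := (abs_nonneg _).trans (hC 0)
  rw [fderiv_truncate hV hη hε ht hu]
  refine ContinuousLinearMap.opNorm_le_bound _ (by positivity) fun v => ?_
  refine (pi_norm_le_iff_of_nonneg (by positivity)).2 fun j => ?_
  simp only [ContinuousLinearMap.pi_apply, smul_apply, smul_eq_mul,
    ContinuousLinearMap.comp_apply, ContinuousLinearMap.proj_apply, norm_mul, mul_assoc]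
  exact mul_le_mul (hC _) ((norm_le_pi_norm _ j).trans ((fderiv ℝ u t).le_opNorm v))
    (norm_nonneg _) hC0

/-- A nonzero coordinate eventually exceeds `2 ε m` in absolute value, where `η` has slope one. A
zero coordinate contributes nothing on either side, by `h0`. The sequence is thus eventually
constant. -/
theorem tendsto_fderiv_truncate (hV : IsOpen V) (hη : ContDiff ℝ 1 η)
    (hη1 : ∀ s, 2 < |s| → deriv η s = 1) {ε : ℕ → ℝ} (hε : ∀ m, 0 < ε m)
    (hlim : Tendsto ε atTop (𝓝 0)) {t : Base n} (ht : t ∈ V) (hu : DifferentiableAt ℝ u t)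
    (h0 : ∀ j, u t j = 0 → ContinuousLinearMap.proj j ∘L fderiv ℝ u t = 0) :
    Tendsto (fun m => fderiv ℝ (truncate V η (ε m) u) t) atTop (𝓝 (fderiv ℝ u t)) := by
  refine tendsto_nhds_of_eventually_eq ?_
  have hev : ∀ j, ∀ᶠ m in atTop, u t j ≠ 0 → deriv η ((ε m)⁻¹ * u t j) = 1 := by
    intro j
    by_cases hj : u t j = 0
    · exact Eventually.of_forall fun m h => (h hj).elim
    · have hpos : 0 < |u t j| / 2 := by positivity
      filter_upwards [hlim.eventually (gt_mem_nhds hpos)] with m hm _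
      refine hη1 _ ?_
      rw [abs_mul, abs_inv, abs_of_pos (hε m), lt_inv_mul_iff₀ (hε m)]
      linarith
  filter_upwards [eventually_all.2 hev] with m hm
  rw [fderiv_truncate hV hη (hε m) ht hu]
  ext v j
  by_cases hj : u t j = 0
  · have := congrArg (fun A : Base n →L[ℝ] ℝ => A v) (h0 j hj)
    simp only [ContinuousLinearMap.comp_apply, ContinuousLinearMap.proj_apply,
      zero_apply] at this
    simp [this]
  · simp [hm j hj]

end truncate

/-! ### Dependence on the boundary values only -/

/-- The integral of a homogeneous null Lagrangian over a bounded open set depends only on the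
boundary values. -/
theorem setIntegral_minorSum_fderiv_eq {n k : ℕ} (hk : 1 ≤ k) {V : Set (Base n)} (hV : IsOpen V)
    (hVb : Bornology.IsBounded V) {φ ψ : Base n → Base n} (hφ : ContDiffOn ℝ 1 φ V)
    (hψ : ContDiffOn ℝ 1 ψ V) (hφc : ContinuousOn φ (closure V))
    (hψc : ContinuousOn ψ (closure V)) {C : ℝ} (hφC : ∀ t ∈ V, ‖fderiv ℝ φ t‖ ≤ C)
    (hψC : ∀ t ∈ V, ‖fderiv ℝ ψ t‖ ≤ C) (heq : ∀ t ∈ frontier V, φ t = ψ t) :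
    ∫ t in V, minorSum k (fderiv ℝ φ t) = ∫ t in V, minorSum k (fderiv ℝ ψ t) := by
  obtain ⟨η, hη, hη0, ⟨C', hC'⟩, hη1⟩ := exists_truncation
  have hC'0 : 0 ≤ C' := (abs_nonneg _).trans (hC' 0)
  set u : Base n → Base n := φ - ψ with hudef
  have hu : ContDiffOn ℝ 1 u V := hφ.sub hψ
  have huc : ContinuousOn u (closure V) := hφc.sub hψc
  have hdiff : ∀ {v : Base n → Base n}, ContDiffOn ℝ 1 v V → ∀ t ∈ V, DifferentiableAt ℝ v t :=
    fun hv t ht => (hv.contDiffAt (hV.mem_nhds ht)).differentiableAt one_ne_zero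
  have hDu : ∀ t ∈ V, fderiv ℝ u t = fderiv ℝ φ t - fderiv ℝ ψ t := fun t ht =>
    fderiv_sub (hdiff hφ t ht) (hdiff hψ t ht)
  have hDuC : ∀ t ∈ V, ‖fderiv ℝ u t‖ ≤ C + C := fun t ht => by
    rw [hDu t ht]
    exact (norm_sub_le _ _).trans (add_le_add (hφC t ht) (hψC t ht))
  set ε : ℕ → ℝ := fun m => 1 / ((m : ℝ) + 1)
  have hε : ∀ m, 0 < ε m := fun m => Nat.one_div_pos_of_nat
  have hsupp : ∀ m, HasCompactSupport (truncate V η (ε m) u) ∧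
      tsupport (truncate V η (ε m) u) ⊆ V := fun m =>
    tsupport_truncate_subset hVb hη0 (hε m) huc (fun t ht => by simp [hudef, heq t ht]) hV
  have hcd : ∀ m, ContDiff ℝ 1 (truncate V η (ε m) u) := fun m =>
    contDiff_truncate hV hη hu (hsupp m).2
  have hzero := fun m => setIntegral_minorSum_add_sub_eq_zero hk hV hψ (hcd m) (hsupp m).1 (hsupp m).2
  -- The radius covers both the derivative of `ψ`, bounded by `C`, and its sum with that of the
  -- truncation, bounded by `C' * (C + C)` at every scale.
  obtain ⟨M, hM⟩ := (isCompact_closedBall (0 : Base n →L[ℝ] Base n)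
    (max C (C + C' * (C + C)))).exists_bound_of_continuousOn (continuous_minorSum k).continuousOn
  have hbound : ∀ A : Base n →L[ℝ] Base n, ‖A‖ ≤ max C (C + C' * (C + C)) →
      ‖minorSum k A‖ ≤ M := fun A hA => hM A (by simpa using hA)
  have hmeas : ∀ {D : Base n → Base n →L[ℝ] Base n}, ContinuousOn D V →
      AEStronglyMeasurable (fun t => minorSum k (D t)) (volume.restrict V) := fun hD =>
    ((continuous_minorSum k).comp_continuousOn hD).aestronglyMeasurable hV.measurableSet
  have hDψ := hψ.continuousOn_fderiv_of_isOpen hV le_rfl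
  have hDφ := hφ.continuousOn_fderiv_of_isOpen hV le_rfl
  have hfin : IsFiniteMeasure (volume.restrict V) := ⟨by
    rw [Measure.restrict_apply_univ]; exact hVb.measure_lt_top⟩
  have hae : ∀ᵐ t ∂volume.restrict V, ∀ j, u t j = 0 →
      ContinuousLinearMap.proj j ∘L fderiv ℝ u t = 0 :=
    ae_all_iff.2 fun j => ae_fderiv_eq_zero_of_eq_zero volume hV fun t ht =>
      hasFDerivAt_pi'.1 (hdiff hu t ht).hasFDerivAt j
  have hlim : Tendsto (fun m => ∫ t in V, (minorSum k (fderiv ℝ ψ t +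
      fderiv ℝ (truncate V η (ε m) u) t) - minorSum k (fderiv ℝ ψ t))) atTop
      (𝓝 (∫ t in V, (minorSum k (fderiv ℝ φ t) - minorSum k (fderiv ℝ ψ t)))) := by
    refine tendsto_integral_of_dominated_convergence (fun _ => M + M) (fun m => ?_)
      (integrable_const _) (fun m => ?_) ?_
    · exact (hmeas (hDψ.add ((hcd m).continuous_fderiv one_ne_zero).continuousOn)).sub (hmeas hDψ)
    · filter_upwards [ae_restrict_mem hV.measurableSet] with t ht
      refine (norm_sub_le _ _).trans (add_le_add (hbound _ ?_) (hbound _ ?_))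
      · refine le_max_of_le_right ((norm_add_le _ _).trans (add_le_add (hψC t ht) ?_))
        exact (norm_fderiv_truncate_le hV hη (hε m) hC' ht (hdiff hu t ht)).trans
          (mul_le_mul_of_nonneg_left (hDuC t ht) hC'0)
      · exact le_max_of_le_left (hψC t ht)
    · filter_upwards [hae, ae_restrict_mem hV.measurableSet] with t ht htV
      have h := tendsto_fderiv_truncate hV hη hη1 hε tendsto_one_div_add_atTop_nhds_zero_nat htV
        (hdiff hu t htV) ht
      have h' := ((continuous_minorSum k).tendsto _).comp (h.const_add (fderiv ℝ ψ t))
      rw [hDu t htV, add_sub_cancel] at h'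
      exact h'.sub_const _
  simp_rw [hzero] at hlim
  have hint : ∀ {v : Base n → Base n}, ContinuousOn (fderiv ℝ v) V →
      (∀ t ∈ V, ‖fderiv ℝ v t‖ ≤ C) →
      Integrable (fun t => minorSum k (fderiv ℝ v t)) (volume.restrict V) := fun hv hvC =>
    Integrable.of_bound (hmeas hv) M <| by
      filter_upwards [ae_restrict_mem hV.measurableSet] with t ht
      exact hbound _ (le_max_of_le_left (hvC t ht))
  have h0 := tendsto_nhds_unique hlim tendsto_const_nhds
  rwa [integral_sub (hint hDφ hφC) (hint hDψ hψC), sub_eq_zero] at h0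

/-! ### The forms on tangent vectors of a graph -/

theorem alternatingMap_sum_apply {R M N ι κ : Type*} [Semiring R] [AddCommMonoid M] [Module R M]
    [AddCommMonoid N] [Module R N] (s : Finset κ) (F : κ → M [⋀^ι]→ₗ[R] N) (v : ι → M) :
    (∑ i ∈ s, F i) v = ∑ i ∈ s, F i v :=
  map_sum (⟨⟨fun F => F v, rfl⟩, fun _ _ => rfl⟩ : M [⋀^ι]→ₗ[R] N →+ N) F s

/-- With the indices split into `K` and its complement, the matrix is block triangular, and the
block outside `K` is the identity. -/
theorem det_piecewise_one {n : ℕ} (C : Matrix (Fin n) (Fin n) ℝ) (K : Finset (Fin n)) :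
    (Matrix.of fun i j => if i ∈ K then C i j else (1 : Matrix (Fin n) (Fin n) ℝ) i j).det =
      principalMinor C K := by
  set M : Matrix (Fin n) (Fin n) ℝ :=
    Matrix.of fun i j => if i ∈ K then C i j else (1 : Matrix (Fin n) (Fin n) ℝ) i j with hM
  have h0 : ∀ i, i ∉ K → ∀ j, j ∈ K → M i j = 0 := fun i hi j hj => by
    simp [hM, hi, Matrix.one_apply_ne (show i ≠ j from fun h => hi (h ▸ hj))]
  have h1 : (M.toSquareBlockProp fun i => i ∉ K) = 1 := by
    ext i j
    simp [hM, Matrix.toSquareBlockProp, Matrix.one_apply, i.2, Subtype.ext_iff]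
  have h2 : M.toSquareBlockProp (· ∈ K) = C.submatrix (fun i : K => (i : Fin n)) fun i : K => i := by
    ext i j
    simp [hM, Matrix.toSquareBlockProp]
  rw [Matrix.twoBlockTriangular_det M (· ∈ K) h0, h1, h2, Matrix.det_one, mul_one, principalMinor]
  congr!

/-- The tangent vectors of the graph of a map with derivative `D`. -/
def graphTangent {n ν : ℕ} (D : Base n →L[ℝ] Fib ν) (j : Fin n) : Base n × Fib ν :=
  (Pi.single j 1, D (Pi.single j 1))

theorem wedge_graphTangent {n ν : ℕ} (K : Finset (Fin n))
    (θ : Fin n → (Base n × Fib ν →ₗ[ℝ] ℝ)) (D : Base n →L[ℝ] Fib ν) :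
    wedge (fun i => if i ∈ K then θ i else dt i) (graphTangent D) =
      principalMinor (Matrix.of fun i j => θ i (graphTangent D j)) K := by
  rw [wedge_apply, ← Matrix.det_transpose, ← det_piecewise_one]
  congr 1
  ext i j
  by_cases hi : i ∈ K
  · simp [hi]
  · simp [hi, dt, graphTangent, Matrix.one_apply, Pi.single_apply]

theorem minorSum_eq_sum_principalMinor {n : ℕ} (k : ℕ) (A : Base n →L[ℝ] Base n) :
    minorSum k A = ∑ K ∈ (Finset.univ : Finset (Fin n)).powersetCard k,
      principalMinor (Matrix.of fun i j => A (Pi.single j 1) i) K :=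
  Finset.sum_congr rfl fun K _ => by rw [← det_piecewise_one]; rfl

/-- By the chain rule, `dS^i` on the `j`-th tangent vector is the `(i, j)` entry of the derivative
of `S` along the graph. This identifies the pulled-back form as a null Lagrangian. -/
theorem actionForm_graphTangent {n ν : ℕ} (k : ℕ) {S : Base n × Fib ν → Fin n → ℝ}
    {z : Base n × Fib ν} (hS : DifferentiableAt ℝ S z) (D : Base n →L[ℝ] Fib ν) :
    actionForm k S z (graphTangent D) =
      minorSum k (fderiv ℝ S z ∘L (ContinuousLinearMap.id ℝ (Base n)).prod D) := by
  rw [actionForm, alternatingMap_sum_apply, minorSum_eq_sum_principalMinor]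
  refine Finset.sum_congr rfl fun K _ => ?_
  rw [wedge_graphTangent]
  congr 1
  ext i j
  have h := (hasFDerivAt_pi'.1 hS.hasFDerivAt i).fderiv
  simp [dS, h, graphTangent]

/-- On the `j`-th tangent vector, `ω^α` equals `q α j - g α j`, and `dt^i` gives the identity
matrix. -/
theorem weierstrass_eq_sub_hilbertForm {n ν : ℕ} (k : ℕ) (f : Base n → Fib ν → Slope n ν → ℝ)
    (g : Base n → Fib ν → Slope n ν) (z : Base n × Fib ν) (D : Base n →L[ℝ] Fib ν) :
    weierstrass k f g z.1 z.2 (fun α i => D (Pi.single i 1) α) =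
      f z.1 z.2 (fun α i => D (Pi.single i 1) α) - hilbertForm k f g z (graphTangent D) := by
  rw [weierstrass, hilbertForm, alternatingMap_sum_apply]
  congr 1
  refine Finset.sum_congr rfl fun K _ => ?_
  rw [AlternatingMap.smul_apply, wedge_graphTangent, smul_eq_mul]
  congr 2
  ext i j
  simp [canonicalForm, dt, dx, graphTangent, Matrix.one_apply, Pi.single_apply]

theorem weierstrass_self {n ν k : ℕ} (hk : 1 ≤ k) (hkn : k ≤ n)
    (f : Base n → Fib ν → Slope n ν → ℝ) (g : Base n → Fib ν → Slope n ν) (t : Base n) (x : Fib ν)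
    (h0 : f t x (g t x) ^ (k - 1) ≠ 0) : weierstrass k f g t x (g t x) = 0 := by
  -- The power `f̂^k` is split because only `f̂^(k-1)` is known to be nonzero; for `k = 1` the value
  -- `f̂` itself may vanish.
  have hminor : ∀ K ∈ (Finset.univ : Finset (Fin n)).powersetCard k,
      principalMinor (f t x (g t x) • (1 : Matrix (Fin n) (Fin n) ℝ)) K =
        f t x (g t x) ^ (k - 1) * f t x (g t x) := fun K hK => by
    rw [principalMinor, Matrix.submatrix_smul, Pi.smul_apply, Pi.smul_apply,
      Matrix.submatrix_one _ Subtype.val_injective, Matrix.det_smul, Matrix.det_one, mul_one,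
      Fintype.card_coe, (Finset.mem_powersetCard.1 hK).2, ← pow_succ, Nat.sub_add_cancel hk]
  have hmat : (Matrix.of fun i j =>
      f t x (g t x) * (1 : Matrix (Fin n) (Fin n) ℝ) i j + (n : ℝ) / (k : ℝ) *
        ∑ α, momentum f t x (g t x) i α * (g t x α j - g t x α j)) =
      f t x (g t x) • (1 : Matrix (Fin n) (Fin n) ℝ) := by
    ext i j
    simp
  have hC : (n.choose k : ℝ) ≠ 0 := by exact_mod_cast (Nat.choose_pos hkn).ne'
  rw [weierstrass, hmat, Finset.sum_congr rfl fun K hK => by rw [hminor K hK], Finset.sum_const,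
    Finset.card_powersetCard, Finset.card_univ, Fintype.card_fin, nsmul_eq_mul]
  field_simp
  ring

/-! ### Comparison of manifolds -/

section

variable {n ν : ℕ} {V : Set (Base n)} {𝒱 : Set (Base n × Fib ν)}

theorem IsC1OnClosure.contDiffOn {x : Base n → Fib ν} (hV : IsOpen V) (hx : IsC1OnClosure V x) :
    ContDiffOn ℝ 1 x V := by
  obtain ⟨-, D, hD, hxD⟩ := hx
  rw [show (1 : WithTop ℕ∞) = 0 + 1 from rfl,
    contDiffOn_succ_iff_hasFDerivWithinAt_of_uniqueDiffOn hV.uniqueDiffOn]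
  exact ⟨by simp, D, contDiffOn_zero.2 (hD.mono subset_closure), fun t ht =>
    (hxD t ht).hasFDerivWithinAt⟩

theorem integrableOn_of_continuousOn_closure (hVb : Bornology.IsBounded V) {h : Base n → ℝ}
    (hh : ContinuousOn h (closure V)) : IntegrableOn h V :=
  (hh.integrableOn_compact hVb.isCompact_closure).mono_set subset_closure

/-- A `C¹` map is `C¹` along a `C¹` manifold, and its derivative there extends continuously to the
closure of the chart. -/
theorem contDiffOn_comp_graph (hV : IsOpen V) (h𝒱 : IsOpen 𝒱)
    {S : Base n × Fib ν → Base n} (hS : ContDiffOn ℝ 1 S 𝒱) {x : Base n → Fib ν}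
    (hx : IsC1OnClosure V x) (hx𝒱 : LiesIn V 𝒱 x) :
    ContDiffOn ℝ 1 (fun t => S (t, x t)) V ∧ ContinuousOn (fun t => S (t, x t)) (closure V) ∧
      (∀ t ∈ V, fderiv ℝ (fun t => S (t, x t)) t =
        fderiv ℝ S (t, x t) ∘L (ContinuousLinearMap.id ℝ (Base n)).prod (fderiv ℝ x t)) ∧
      ∃ Φ : Base n → Base n →L[ℝ] Base n, ContinuousOn Φ (closure V) ∧
        ∀ t ∈ V, fderiv ℝ (fun t => S (t, x t)) t = Φ t := by
  have hgraph : ContinuousOn (fun t => (t, x t)) (closure V) := continuousOn_id.prodMk hx.1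
  have hderiv : ∀ t ∈ V, fderiv ℝ (fun t => S (t, x t)) t =
      fderiv ℝ S (t, x t) ∘L (ContinuousLinearMap.id ℝ (Base n)).prod (fderiv ℝ x t) := by
    intro t ht
    have hxt := ((hx.contDiffOn hV).contDiffAt (hV.mem_nhds ht)).differentiableAt one_ne_zero
    have hSt := (hS.contDiffAt (h𝒱.mem_nhds (hx𝒱 t (subset_closure ht)))).differentiableAt
      one_ne_zero
    exact (hSt.hasFDerivAt.comp t ((hasFDerivAt_id t).prodMk hxt.hasFDerivAt)).fderiv
  refine ⟨hS.comp (contDiffOn_id.prodMk (hx.contDiffOn hV)) fun t ht => hx𝒱 t (subset_closure ht),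
    hS.continuousOn.comp hgraph hx𝒱, hderiv, ?_⟩
  obtain ⟨D, hD, hxD⟩ := hx.2
  refine ⟨fun t => fderiv ℝ S (t, x t) ∘L (ContinuousLinearMap.id ℝ (Base n)).prod (D t), ?_,
    fun t ht => by rw [hderiv t ht, (hxD t ht).fderiv]⟩
  refine ((hS.continuousOn_fderiv_of_isOpen h𝒱 le_rfl).comp hgraph hx𝒱).clm_comp ?_
  exact (ContinuousLinearMap.prodₗᵢ ℝ).continuous.comp_continuousOn (continuousOn_const.prodMk hD)

/-- The Weierstrass function along a manifold is the excess of the integrand over the form of the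
action functions. -/
theorem weierstrass_jac_eq (hV : IsOpen V) (h𝒱 : IsOpen 𝒱) {k : ℕ}
    {f : Base n → Fib ν → Slope n ν → ℝ} {S : Base n × Fib ν → Base n}
    (hS : ContDiffOn ℝ 1 S 𝒱) {g : Base n → Fib ν → Slope n ν} (hrep : Represents k f S 𝒱 g)
    {x : Base n → Fib ν} (hx : IsC1OnClosure V x) (hx𝒱 : LiesIn V 𝒱 x) {t : Base n} (ht : t ∈ V) :
    weierstrass k f g t (x t) (jac x t) =
      f t (x t) (jac x t) - minorSum k (fderiv ℝ (fun t => S (t, x t)) t) := by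
  have hz := hx𝒱 t (subset_closure ht)
  rw [(contDiffOn_comp_graph hV h𝒱 hS hx hx𝒱).2.2.1 t ht, ← actionForm_graphTangent k
    ((hS.contDiffAt (h𝒱.mem_nhds hz)).differentiableAt one_ne_zero), ← (hrep _ hz).2]
  exact weierstrass_eq_sub_hilbertForm k f g (t, x t) (fderiv ℝ x t)

/-- A manifold embedded in the slope field minimizes the functional in comparison with every
manifold along which the Weierstrass function is nonnegative. -/
theorem functional_le_of_weierstrass_nonneg {k : ℕ} (hk : 1 ≤ k) (hkn : k ≤ n) (hV : IsOpen V)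
    (hVb : Bornology.IsBounded V) (h𝒱 : IsOpen 𝒱) {f : Base n → Fib ν → Slope n ν → ℝ}
    (hfc : ContinuousOn (fun y : (Base n × Fib ν) × Slope n ν => f y.1.1 y.1.2 y.2)
      (𝒱 ×ˢ Set.univ)) {S : Base n × Fib ν → Fin n → ℝ} (hS : ContDiffOn ℝ 1 S 𝒱)
    {g : Base n → Fib ν → Slope n ν} (hrep : Represents k f S 𝒱 g) {x y : Base n → Fib ν}
    (hy : IsC1OnClosure V y) (hy𝒱 : LiesIn V 𝒱 y) (hyg : IsEmbedded V g y)
    (hx : IsC1OnClosure V x) (hx𝒱 : LiesIn V 𝒱 x) (hxy : SameBoundary V x y)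
    (hE : ∀ t ∈ V, weierstrass k f g t (x t) (g t (x t)) ≤
      weierstrass k f g t (x t) (jac x t)) : functional V f y ≤ functional V f x := by
  obtain ⟨hφ, hφc, -, Φ, hΦ, hφΦ⟩ := contDiffOn_comp_graph hV h𝒱 hS hx hx𝒱
  obtain ⟨hψ, hψc, -, Ψ, hΨ, hψΨ⟩ := contDiffOn_comp_graph hV h𝒱 hS hy hy𝒱
  -- The continuous extensions to the compact closure supply the derivative bounds needed for the
  -- independence of the integral.
  obtain ⟨C₁, hC₁⟩ := hVb.isCompact_closure.exists_bound_of_continuousOn hΦ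
  obtain ⟨C₂, hC₂⟩ := hVb.isCompact_closure.exists_bound_of_continuousOn hΨ
  have hnull := setIntegral_minorSum_fderiv_eq hk hV hVb hφ hψ hφc hψc (C := max C₁ C₂)
    (fun t ht => (hφΦ t ht ▸ hC₁ t (subset_closure ht)).trans (le_max_left _ _))
    (fun t ht => (hψΨ t ht ▸ hC₂ t (subset_closure ht)).trans (le_max_right _ _))
    fun t ht => by rw [hxy t ht]
  have hint : IntegrableOn (fun t => minorSum k (fderiv ℝ (fun t => S (t, x t)) t)) V :=
    (integrableOn_of_continuousOn_closure hVb ((continuous_minorSum k).comp_continuousOn hΦ)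
      ).congr_fun (fun t ht => by simp only [Function.comp_apply, hφΦ t ht]) hV.measurableSet
  have hfint : IntegrableOn (fun t => f t (x t) (jac x t)) V := by
    obtain ⟨D, hD, hxD⟩ := hx.2
    have hjac : ContinuousOn (fun t => (fun α i => D t (Pi.single i 1) α : Slope n ν))
        (closure V) := by
      refine continuousOn_pi.2 fun α => continuousOn_pi.2 fun i => ?_
      exact (continuous_apply α).comp_continuousOn (hD.clm_apply continuousOn_const)
    refine (integrableOn_of_continuousOn_closure hVb (hfc.comp
      ((continuousOn_id.prodMk hx.1).prodMk hjac) fun t ht => ⟨hx𝒱 t ht, Set.mem_univ _⟩)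
      ).congr_fun (fun t ht => ?_) hV.measurableSet
    have hj : jac x t = fun α i => D t (Pi.single i 1) α := by
      funext α i
      rw [jac, (hxD t ht).fderiv]
    simp only [Function.comp_apply, hj, id]
  -- The minimal value of the Weierstrass function is zero, so `hE` makes the excess of `f` over the
  -- minors nonnegative.
  have hW : ∀ t ∈ V, minorSum k (fderiv ℝ (fun t => S (t, x t)) t) ≤ f t (x t) (jac x t) := by
    intro t ht
    have h := hE t ht
    rw [weierstrass_self hk hkn f g t (x t) (hrep _ (hx𝒱 t (subset_closure ht))).1,
      weierstrass_jac_eq hV h𝒱 hS hrep hx hx𝒱 ht] at h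
    linarith
  have hWy : ∀ t ∈ V, f t (y t) (jac y t) = minorSum k (fderiv ℝ (fun t => S (t, y t)) t) := by
    intro t ht
    have h := weierstrass_jac_eq hV h𝒱 hS hrep hy hy𝒱 ht
    have h0 := weierstrass_self hk hkn f g t (y t) (hrep _ (hy𝒱 t (subset_closure ht))).1
    rw [← hyg t ht] at h0
    linarith
  calc functional V f y = ∫ t in V, minorSum k (fderiv ℝ (fun t => S (t, y t)) t) :=
        setIntegral_congr_fun hV.measurableSet hWy
    _ = ∫ t in V, minorSum k (fderiv ℝ (fun t => S (t, x t)) t) := hnull.symm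
    _ ≤ functional V f x := setIntegral_mono_on hint hfint hV.measurableSet hW

/-! ### Uniform neighbourhoods of the embedded manifold -/

theorem norm_sub_lt_of_mem_closure (hV : IsOpen V) {x y : Base n → Fib ν} {ε : ℝ} (hε : 0 < ε)
    (hxy : SameBoundary V x y) (h : ∀ t ∈ V, ‖x t - y t‖ < ε) {t : Base n} (ht : t ∈ closure V) :
    ‖x t - y t‖ < ε := by
  by_cases htV : t ∈ V
  · exact h t htV
  · rw [hxy t (hV.frontier_eq ▸ ⟨ht, htV⟩), sub_self, norm_zero]
    exact hε

/-- The graph over the closure is compact, so some thickening of it stays in the open set `𝒱`. -/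
theorem exists_liesIn_of_norm_sub_lt (hV : IsOpen V) (hVb : Bornology.IsBounded V)
    (h𝒱 : IsOpen 𝒱) {y : Base n → Fib ν} (hy : ContinuousOn y (closure V))
    (hy𝒱 : LiesIn V 𝒱 y) : ∃ ε : ℝ, 0 < ε ∧ ∀ x : Base n → Fib ν, SameBoundary V x y →
      (∀ t ∈ V, ‖x t - y t‖ < ε) → LiesIn V 𝒱 x := by
  have hK : IsCompact ((fun t => (t, y t)) '' closure V) :=
    hVb.isCompact_closure.image_of_continuousOn (continuousOn_id.prodMk hy)
  obtain ⟨ε, hε, hsub⟩ := hK.exists_thickening_subset_open h𝒱 (by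
    rintro _ ⟨t, ht, rfl⟩
    exact hy𝒱 t ht)
  refine ⟨ε, hε, fun x hxy h t ht => hsub ?_⟩
  refine Metric.mem_thickening_iff.2 ⟨_, ⟨t, ht, rfl⟩, ?_⟩
  rw [Prod.dist_eq, dist_self, max_lt_iff, dist_eq_norm]
  exact ⟨hε, norm_sub_lt_of_mem_closure hV hε hxy h ht⟩

/-- On a compact set the neighbourhoods in which the Weierstrass function is minimal can be chosen
of the same size, and centred at the values of the slope field at nearby points. -/
theorem exists_uniform_weierstrass_le (h𝒱 : IsOpen 𝒱) {k : ℕ}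
    {f : Base n → Fib ν → Slope n ν → ℝ} {S : Base n × Fib ν → Fin n → ℝ}
    {g : Base n → Fib ν → Slope n ν} (hg : ContinuousOn (fun z : Base n × Fib ν => g z.1 z.2) 𝒱)
    (hgeo : IsLocallyGeodesic k f S 𝒱 g) {K : Set (Base n × Fib ν)} (hK : IsCompact K)
    (hK𝒱 : K ⊆ 𝒱) :
    ∃ r : ℝ, 0 < r ∧ ∀ z₀ ∈ K, ∀ z ∈ Metric.ball z₀ r, ∀ q : Slope n ν, ‖q - g z₀.1 z₀.2‖ < r →
      weierstrass k f g z.1 z.2 (g z.1 z.2) ≤ weierstrass k f g z.1 z.2 q := by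
  refine hK.induction_on (p := fun s => ∃ r : ℝ, 0 < r ∧ ∀ z₀ ∈ s, ∀ z ∈ Metric.ball z₀ r,
    ∀ q : Slope n ν, ‖q - g z₀.1 z₀.2‖ < r →
      weierstrass k f g z.1 z.2 (g z.1 z.2) ≤ weierstrass k f g z.1 z.2 q)
    ⟨1, one_pos, fun z₀ h => h.elim⟩ ?_ ?_ ?_
  · rintro s t hst ⟨r, hr, h⟩
    exact ⟨r, hr, fun z₀ hz₀ => h z₀ (hst hz₀)⟩
  · rintro s t ⟨r, hr, h⟩ ⟨r', hr', h'⟩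
    refine ⟨min r r', lt_min hr hr', fun z₀ hz₀ z hz q hq => ?_⟩
    rcases hz₀ with hz₀ | hz₀
    · exact h z₀ hz₀ z (Metric.ball_subset_ball (min_le_left _ _) hz) q
        (hq.trans_le (min_le_left _ _))
    · exact h' z₀ hz₀ z (Metric.ball_subset_ball (min_le_right _ _) hz) q
        (hq.trans_le (min_le_right _ _))
  · intro z₀ hz₀
    obtain ⟨U, hU, δ, hδ, hmin⟩ := hgeo.2 z₀ (hK𝒱 hz₀)
    have hgz : ∀ᶠ z in 𝓝 z₀, ‖g z.1 z.2 - g z₀.1 z₀.2‖ < δ / 4 := by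
      have := (hg.continuousAt (h𝒱.mem_nhds (hK𝒱 hz₀))).eventually
        (Metric.ball_mem_nhds _ (show 0 < δ / 4 by positivity))
      simpa [dist_eq_norm] using this
    obtain ⟨ρ, hρ, hball⟩ := Metric.eventually_nhds_iff_ball.1
      ((h𝒱.eventually_mem (hK𝒱 hz₀)).and ((eventually_mem_set.2 hU).and hgz))
    -- With `ρ / 2` twice, `z` stays within `ρ` of `z₀`. With `δ / 4`, the distance from `q` to `g`
    -- at `z` is below `3δ/4`: one quarter from `q` to `g` at `z₁`, and one for each of the two
    -- comparisons with `g` at `z₀`.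
    refine ⟨Metric.ball z₀ (ρ / 2), mem_nhdsWithin_of_mem_nhds
      (Metric.ball_mem_nhds _ (by positivity)), min (ρ / 2) (δ / 4), by positivity, ?_⟩
    intro z₁ hz₁ z hz q hq
    have hz₁' := hball z₁ (Metric.ball_subset_ball (by linarith) hz₁)
    have hz' := hball z (by
      rw [Metric.mem_ball] at hz₁ hz ⊢
      linarith [dist_triangle z z₁ z₀, hz.trans_le (min_le_left (ρ / 2) (δ / 4))])
    refine hmin z ⟨hz'.1, hz'.2.1⟩ q ?_
    have h1 := hq.trans_le (min_le_right (ρ / 2) (δ / 4))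
    have h2 := hz₁'.2.2
    have h3 := hz'.2.2
    have e : q - g z.1 z.2 = (q - g z₁.1 z₁.2) + ((g z₁.1 z₁.2 - g z₀.1 z₀.2) -
        (g z.1 z.2 - g z₀.1 z₀.2)) := by abel
    rw [e]
    refine (norm_add_le _ _).trans_lt ?_
    linarith [norm_sub_le (g z₁.1 z₁.2 - g z₀.1 z₀.2) (g z.1 z.2 - g z₀.1 z₀.2)]

end

end FieldTheory

end

theorem theorem4 {n ν : ℕ} (k : ℕ) (hk : 1 ≤ k) (hkn : k ≤ n)
    (V : Set (FieldTheory.Base n)) (hVo : IsOpen V) (hVb : Bornology.IsBounded V)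
    (𝒱 : Set (FieldTheory.Base n × FieldTheory.Fib ν)) (h𝒱 : IsOpen 𝒱)
    (f : FieldTheory.Base n → FieldTheory.Fib ν → FieldTheory.Slope n ν → ℝ)
    (hfc : ContinuousOn
      (fun y : (FieldTheory.Base n × FieldTheory.Fib ν) × FieldTheory.Slope n ν =>
        f y.1.1 y.1.2 y.2) (𝒱 ×ˢ Set.univ))
    (hfd : ∀ z ∈ 𝒱, Differentiable ℝ (f z.1 z.2))
    (S : FieldTheory.Base n × FieldTheory.Fib ν → Fin n → ℝ) (hS : ContDiffOn ℝ 1 S 𝒱)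
    (g : FieldTheory.Base n → FieldTheory.Fib ν → FieldTheory.Slope n ν)
    (hg : ContinuousOn (fun z : FieldTheory.Base n × FieldTheory.Fib ν => g z.1 z.2) 𝒱)
    (xhat : FieldTheory.Base n → FieldTheory.Fib ν)
    (hx : FieldTheory.IsC1OnClosure V xhat) (hx𝒱 : FieldTheory.LiesIn V 𝒱 xhat)
    (hxg : FieldTheory.IsEmbedded V g xhat) :
    (FieldTheory.IsGeodesic k f S 𝒱 g →
      (∀ x : FieldTheory.Base n → FieldTheory.Fib ν,
        FieldTheory.IsC1OnClosure V x → FieldTheory.LiesIn V 𝒱 x →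
        FieldTheory.SameBoundary V x xhat →
        FieldTheory.functional V f xhat ≤ FieldTheory.functional V f x) ∧
      FieldTheory.IsStrongLocalMin V f xhat) ∧
    (FieldTheory.IsLocallyGeodesic k f S 𝒱 g → FieldTheory.IsWeakLocalMin V f xhat) := by
  have hstrong := FieldTheory.exists_liesIn_of_norm_sub_lt hVo hVb h𝒱 hx.1 hx𝒱
  refine ⟨fun hgeo => ?_, fun hgeo => ?_⟩
  · have hmin : ∀ x : FieldTheory.Base n → FieldTheory.Fib ν,
        FieldTheory.IsC1OnClosure V x → FieldTheory.LiesIn V 𝒱 x →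
        FieldTheory.SameBoundary V x xhat →
        FieldTheory.functional V f xhat ≤ FieldTheory.functional V f x := fun x hx' hx𝒱' hb =>
      FieldTheory.functional_le_of_weierstrass_nonneg hk hkn hVo hVb h𝒱 hfc hS hgeo.1 hx hx𝒱 hxg
        hx' hx𝒱' hb fun t ht => hgeo.2 (t, x t) (hx𝒱' t (subset_closure ht)) _
    obtain ⟨ε, hε, h⟩ := hstrong
    exact ⟨hmin, ε, hε, fun x hx' hb hlt => hmin x hx' (h x hb hlt) hb⟩
  · obtain ⟨ε, hε, h⟩ := hstrong
    obtain ⟨r, hr, hmin⟩ := FieldTheory.exists_uniform_weierstrass_le h𝒱 hg hgeo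
      (hVb.isCompact_closure.image_of_continuousOn (continuousOn_id.prodMk hx.1)) (by
        rintro _ ⟨t, ht, rfl⟩
        exact hx𝒱 t ht)
    refine ⟨min ε r, lt_min hε hr, fun x hx' hb hlt hjac => ?_⟩
    refine FieldTheory.functional_le_of_weierstrass_nonneg hk hkn hVo hVb h𝒱 hfc hS hgeo.1 hx hx𝒱
      hxg hx' (h x hb fun t ht => (hlt t ht).trans_le (min_le_left _ _)) hb fun t ht => ?_
    -- The centre is the point of the embedded manifold over `t`: there `g` equals the derivative of
    -- `xhat`, so closeness of derivatives is the required bound, although the Weierstrass function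
    -- is taken at `(t, x t)`.
    refine hmin _ ⟨t, subset_closure ht, rfl⟩ (t, x t) ?_ (FieldTheory.jac x t) ?_
    · rw [Metric.mem_ball, Prod.dist_eq, max_lt_iff, dist_eq_norm, dist_eq_norm]
      exact ⟨by simpa using hr, (hlt t ht).trans_le (min_le_right _ _)⟩
    · have := (hjac t ht).trans_le (min_le_right _ _)
      rwa [hxg t ht] at this
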